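/- **Setting.** Let $Z$ be a bounded metric space with at least two points. For a family $\mathcal U$ of subsets of $Z$ put $\operatorname{mesh}\mathcal U=\sup_{U\in\mathcal U}\operatorname{diam}U$ and, for an open covering, $L(\mathcal U)=\inf_{z\in Z}\min\{\sup_{U\in\mathcal U}\operatorname{dist}(z,Z\setminus U),\operatorname{mesh}\mathcal U\}$ (with $\operatorname{dist}(z,\emptyset)=\infty$). A covering is $m$-colored if it is a union $\bigcup_{c\in C}\mathcal U^c$, $|C|=m$, of families $\mathcal U^c$ each consisting of pairwise disjoint sets. The capacity dimension $\operatorname{cdim}Z$ is the least integer $m\ge0$ for which there is $\delta>0$ such that for all sufficiently small $\tau>0$ there is an $(m+1)$-colored open covering $\mathcal U$ of $Z$ with $\operatorname{mesh}\mathcal U\le\tau$ and $L(\mathcal U)\ge\delta\tau$. A hyperbolic approximation $X$ of $Z$ with parameter $r\in(0,1/6]$ is the following graph. Let $k_0$ be the largest integer with $\operatorname{diam}Z<r^{k_0}$, and for each integer $k\ge k_0$ let $V_k\subset Z$ be a maximal set whose distinct points are at distance $\ge r^k$. The vertex set $V$ is the disjoint union of the $V_k$; for $v\in V_k$ write $\ell(v)=k$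 and let $B(v)$, $\overline B(v)$ be the open and closed balls in $Z$ of radius $2r^k$ about $v$. Distinct $v,v'$ are joined by an edge if and only if either $\ell(v)=\ell(v')$ and $\overline B(v)\cap\overline B(v')\ne\emptyset$, or $\ell(v')=\ell(v)+1$ and $B(v')\subset B(v)$ (or vice versa). $|vv'|$ denotes the path metric with edges of length 1. Let $|C|=n+1$. A sequence $\mathcal U_j$, $j\ge0$, of $C$-colored open coverings of $Z$ by nonempty sets with $\mathcal U_0^c=\{Z\}$ for every $c\in C$ is called adapted to $X$ if (1) $\operatorname{mesh}\mathcal U_j<r^j$ for all $j\ge1$; (2) for every $j\ge0$ and $v\in V$ with $\ell(v)=j+1$ there is $U\in\mathcal U_j$ with $B(v)\subset U$; (3) for every $c\in C$ and different members $U\in\mathcal U_j^c$, $U'\in\mathcal U_{j'}^c$, $j'\le j$ (members with different indices count as different), the set $B(U)=\bigcup\{B(v):\ell(v)=j+1,\ B(v)\cap U\neq\emptyset\}$ satisfies $B(U)\subset U'$ or $B(U)\cap U'=\emptyset$. For $c\in C$ let $T_c$ be the graph whose vertex set is the disjoint union of the $\mathcal U_j^c$, $j\ge0$; $U'\in\mathcal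 U^c_{j'}$ is an ancestor of $U\in\mathcal U_j^c$ if $j'<j$ and $U\subset U'$, and $U$ is joined by an edge to its ancestors of maximal index. Let $\mathcal L$ be the path metric of $T_c$. Let $f_c:V\to T_c$ send $v$ to the member $U\in\mathcal U^c_{j'}$ with $B(v)\subset U$ and with $j'\le\max\{\ell(v)-1,0\}$ maximal. Let $f=\prod_cf_c:V\to\prod_cT_c$, where the product carries the $\ell_1$-metric, $|f(v)f(v')|=\sum_c\mathcal L(f_c(v),f_c(v'))$. **Theorem.** For every integer $n\ge0$ there are constants $a_1,a_2>0$, $b\ge0$, depending only on $|C|=n+1$, such that for every bounded metric space $Z$ with at least two points and $\operatorname{cdim}Z=n$ the following holds. (a) There is $r_0>0$ such that for every $r\in(0,r_0)$ there is a sequence of $(n+1)$-colored open coverings of $Z$ that is adapted to every hyperbolic approximation of $Z$ with parameter $r$. (b) Let $X$ be a hyperbolic approximation of $Z$ with parameter $r<\min\{\operatorname{diam}Z,1/\operatorname{diam}Z\}$ and let $(\mathcal U_j)$ be any $(n+1)$-colored sequence adapted to $X$. Then $X$ is connected, every $T_c$ is a tree, and $f$ is quasi-isometric: $$a_1|vv'|-b\le|f(v)f(v')|\le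 a_2|vv'|+b\qquad\text{for all }v,v'\in V .$$ Moreover $\mathcal L(f_c(v),f_c(v'))\le2|vv'|+1$ for all $c\in C$ and $v,v'\in V$; and if $B(v)\cap B(v')\neq\emptyset$ for all adjacent $v,v'\in V$, then every $f_c$ is $2$-Lipschitz, $\mathcal L(f_c(v),f_c(v'))\le2|vv'|$. -/

import Mathlib

open scoped ENNReal

noncomputable section

namespace ColoredTrees

/-! ### Colored coverings and capacity dimension -/

/-- `𝒰 c` is the subfamily of color `c`. The union over all colors is an open covering of `Z`, and
each single-colored subfamily is disjoint. -/
structure IsColoredCover {Z C : Type*} [MetricSpace Z] (𝒰 : C → Set (Set Z)) : Prop where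
  isOpen : ∀ c, ∀ U ∈ 𝒰 c, IsOpen U
  disjoint : ∀ c, (𝒰 c).PairwiseDisjoint id
  covers : ∀ z : Z, ∃ c, ∃ U ∈ 𝒰 c, z ∈ U

/-- The mesh: supremum of the diameters of the members. -/
def mesh {Z C : Type*} [MetricSpace Z] (𝒰 : C → Set (Set Z)) : ℝ≥0∞ :=
  ⨆ c, ⨆ U ∈ 𝒰 c, Metric.ediam U

/-- The Lebesgue number at a point, `min (sup_U dist (z, Z \ U)) mesh`; the distance to the empty
set is `∞`. -/
def lebesgueAt {Z C : Type*} [MetricSpace Z] (𝒰 : C → Set (Set Z)) (z : Z) : ℝ≥0∞ :=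
  min (⨆ c, ⨆ U ∈ 𝒰 c, Metric.infEDist z Uᶜ) (mesh 𝒰)

/-- The Lebesgue number of a covering. -/
def lebesgue {Z C : Type*} [MetricSpace Z] (𝒰 : C → Set (Set Z)) : ℝ≥0∞ :=
  ⨅ z, lebesgueAt 𝒰 z

/-- There is `δ > 0` such that for all sufficiently small `τ > 0` there is an `(m+1)`-colored open
covering of mesh at most `τ` and Lebesgue number at least `δ τ`. -/
def CapDimProperty (Z : Type*) [MetricSpace Z] (m : ℕ) : Prop :=
  ∃ δ : ℝ, 0 < δ ∧ ∃ τ₀ : ℝ, 0 < τ₀ ∧ ∀ τ : ℝ, 0 < τ → τ < τ₀ →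
    ∃ 𝒰 : Fin (m + 1) → Set (Set Z), IsColoredCover 𝒰 ∧
      mesh 𝒰 ≤ ENNReal.ofReal τ ∧ ENNReal.ofReal (δ * τ) ≤ lebesgue 𝒰

/-- The capacity dimension of `Z` is (finite and equal to) `n`. -/
def IsCapDim (Z : Type*) [MetricSpace Z] (n : ℕ) : Prop :=
  IsLeast {m | CapDimProperty Z m} n

/-! ### Hyperbolic approximations -/

/-- `a`-separated subsets: distinct points are at distance at least `a`. -/
def IsSeparatedBy {Z : Type*} [MetricSpace Z] (a : ℝ) (S : Set Z) : Prop :=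
  S.Pairwise fun x y => a ≤ dist x y

/-- The data defining a hyperbolic approximation of `Z` with parameter `r`: the level `k₀` of the
root, and a maximal `r ^ k`-separated set `V k` for each `k ≥ k₀`. (The values of `V` below `k₀` are
irrelevant.) -/
structure HypApprox (Z : Type*) [MetricSpace Z] (r : ℝ) where
  pos : 0 < r
  le_sixth : r ≤ 1 / 6
  k₀ : ℤ
  isGreatest : IsGreatest {k : ℤ | Metric.diam (Set.univ : Set Z) < r ^ k} k₀
  V : ℤ → Set Z
  maximal : ∀ k, k₀ ≤ k → Maximal (IsSeparatedBy (r ^ k)) (V k)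

namespace HypApprox

variable {Z : Type*} [MetricSpace Z] {r : ℝ} (X : HypApprox Z r)

/-- The vertex set: the disjoint union of the `V k`, `k ≥ k₀`. -/
def Vertex : Type _ := {p : ℤ × Z // X.k₀ ≤ p.1 ∧ p.2 ∈ X.V p.1}

variable {X}

/-- The level of a vertex. -/
def Vertex.level (v : X.Vertex) : ℤ := v.1.1

/-- The point of `Z` underlying a vertex. -/
def Vertex.center (v : X.Vertex) : Z := v.1.2

/-- The open ball `B(v)` of radius `2 r ^ k`, where `k` is the level of `v`. -/
def Vertex.ball (v : X.Vertex) : Set Z := Metric.ball v.center (2 * r ^ v.level)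

/-- The closed ball with the center and the radius of `B(v)`. -/
def Vertex.closedBall (v : X.Vertex) : Set Z := Metric.closedBall v.center (2 * r ^ v.level)

/-- Radial adjacency: `w` lies one level above `v` and `B(w) ⊆ B(v)`. -/
def Radial (v w : X.Vertex) : Prop := w.level = v.level + 1 ∧ w.ball ⊆ v.ball

/-- Horizontal adjacency: distinct vertices of the same level whose closed balls intersect. -/
def Horizontal (v w : X.Vertex) : Prop :=
  v ≠ w ∧ v.level = w.level ∧ (v.closedBall ∩ w.closedBall).Nonempty

variable (X)

/-- The hyperbolic approximation as a graph; the metric on the vertices is its path metric. -/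
def graph : SimpleGraph X.Vertex where
  Adj v w := Horizontal v w ∨ Radial v w ∨ Radial w v
  symm := ⟨by
    rintro v w (⟨h1, h2, h3⟩ | h | h)
    · exact Or.inl ⟨h1.symm, h2.symm, by rwa [Set.inter_comm]⟩
    · exact Or.inr (Or.inr h)
    · exact Or.inr (Or.inl h)⟩
  loopless := ⟨by
    rintro v (⟨h, -⟩ | ⟨h, -⟩ | ⟨h, -⟩)
    · exact h rfl
    · omega
    · omega⟩

end HypApprox

/-! ### Sequences of colored coverings -/

/-- A sequence of colored open coverings by nonempty sets, the covering of index `0` consisting of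
`Z` alone in each color. -/
structure CoverSeq (Z C : Type*) [MetricSpace Z] where
  family : ℕ → C → Set (Set Z)
  isCover : ∀ j, IsColoredCover (family j)
  nonempty : ∀ j c, ∀ U ∈ family j c, U.Nonempty
  zero : ∀ c, family 0 c = {Set.univ}

/-- `B(U)` for a member `U` of the `j`-th covering: the union of the balls `B(v)` of the vertices
`v` of level `j + 1` that meet `U`. -/
def hull {Z : Type*} [MetricSpace Z] {r : ℝ} (X : HypApprox Z r) (j : ℕ) (U : Set Z) : Set Z :=
  ⋃ v ∈ {v : X.Vertex | v.level = (j : ℤ) + 1 ∧ (v.ball ∩ U).Nonempty}, v.ball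

/-- The three conditions linking a sequence of coverings to a hyperbolic approximation. In the
separation property, members are different as soon as they differ as sets or by their index. -/
structure CoverSeq.Adapted {Z C : Type*} [MetricSpace Z] {r : ℝ} (𝒰 : CoverSeq Z C)
    (X : HypApprox Z r) : Prop where
  mesh_lt : ∀ j : ℕ, 1 ≤ j → mesh (𝒰.family j) < ENNReal.ofReal (r ^ j)
  ball_subset : ∀ (j : ℕ) (v : X.Vertex), v.level = (j : ℤ) + 1 →
    ∃ c, ∃ U ∈ 𝒰.family j c, v.ball ⊆ U
  separation : ∀ (c : C) (j j' : ℕ), j' ≤ j → ∀ U ∈ 𝒰.family j c, ∀ U' ∈ 𝒰.family j' c,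
    (j, U) ≠ (j', U') → hull X j U ⊆ U' ∨ Disjoint (hull X j U) U'

/-! ### Colored trees and the maps into them -/

namespace CoverSeq

variable {Z C : Type*} [MetricSpace Z] (𝒰 : CoverSeq Z C) (c : C)

/-- Vertices of the colored tree `T_c`: the disjoint union over `j` of the families of color `c`. -/
def TreeVertex : Type _ := {p : ℕ × Set Z // p.2 ∈ 𝒰.family p.1 c}

variable {𝒰 c}

/-- The level of a vertex of `T_c`. -/
def TreeVertex.level (u : 𝒰.TreeVertex c) : ℕ := u.1.1

/-- The covering element underlying a vertex of `T_c`. -/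
def TreeVertex.set (u : 𝒰.TreeVertex c) : Set Z := u.1.2

/-- `a` is an ancestor of `u`. -/
def IsAncestor (a u : 𝒰.TreeVertex c) : Prop := a.level < u.level ∧ u.set ⊆ a.set

/-- `a` is an ancestor of `u` of maximal level. -/
def IsParent (a u : 𝒰.TreeVertex c) : Prop :=
  IsAncestor a u ∧ ∀ b : 𝒰.TreeVertex c, IsAncestor b u → b.level ≤ a.level

variable (𝒰 c)

/-- The colored tree `T_c` as a graph. -/
def tree : SimpleGraph (𝒰.TreeVertex c) where
  Adj u w := IsParent u w ∨ IsParent w u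
  symm := ⟨fun _ _ h => h.symm⟩
  loopless := ⟨by
    rintro u (h | h)
    · exact lt_irrefl _ h.1.1
    · exact lt_irrefl _ h.1.1⟩

variable {r : ℝ} {X : HypApprox Z r}

open Classical in
/-- The largest index `j' ≤ max (level v - 1) 0` such that some member of color `c` of the `j'`-th
covering contains `B(v)`. -/
def mapLevel (v : X.Vertex) : ℕ :=
  Nat.findGreatest (fun j => ∃ U ∈ 𝒰.family j c, v.ball ⊆ U) (v.level - 1).toNat

lemma mapLevel_spec (v : X.Vertex) : ∃ U ∈ 𝒰.family (𝒰.mapLevel c v) c, v.ball ⊆ U := by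
  classical
  have h0 : ∃ U ∈ 𝒰.family 0 c, v.ball ⊆ U := ⟨Set.univ, by simp [𝒰.zero], Set.subset_univ _⟩
  exact Nat.findGreatest_spec (P := fun j => ∃ U ∈ 𝒰.family j c, v.ball ⊆ U) (Nat.zero_le _) h0

/-- The map `f_c`: a vertex `v` goes to the member of color `c` and of index `mapLevel` that
contains `B(v)` (it is unique, since members of equal color and index are disjoint). Vertices of
level `≤ 0`, among them the root, go to the root `Z` of `T_c`. -/
def treeMap (v : X.Vertex) : 𝒰.TreeVertex c :=
  ⟨(𝒰.mapLevel c v, Classical.choose (𝒰.mapLevel_spec c v)),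
    (Classical.choose_spec (𝒰.mapLevel_spec c v)).1⟩

/-- The `ℓ¹` distance between `f v` and `f w` in the product of the trees, `f = ∏ f_c`. -/
def prodDist [Fintype C] (v w : X.Vertex) : ℝ :=
  ∑ c, ((𝒰.tree c).dist (𝒰.treeMap c v) (𝒰.treeMap c w) : ℝ)

end CoverSeq

end ColoredTrees

end

/-!
For (a), shrink coverings of mesh about `r ^ j` to their cores. Members of one color and index then
have diameter at most `r ^ j / 2` and are far apart on the scale `r ^ (j + 1)`. Enlarge each of
them by all chains of finer members that it meets. Such chains are shorter than `r ^ (j + 1)`, so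
sets of one index stay disjoint, while sets of different indices become nested or disjoint.

For (b), `f_c` moves the ends of a radial edge by at most `2` and those of a horizontal edge by at
most `3`, and any two vertices are joined by a geodesic that descends, uses at most one horizontal
edge, and ascends; this is the upper bound. For the lower bound, distances in `T_c` dominate the
number of ancestors that the two vertices do not share. If the centers of `v` and `w` separate at
level `m`, then for each index `j` strictly between `m` and `ℓ(v)` some `f_c(v)` has an ancestor of
index `j` which is not one of `f_c(w)`, because the mesh is below `r ^ j`. On the other hand,
`|vw| ≤ ℓ(v) + ℓ(w) - 2 m + 1`.
-/

/-! ### Thickenings and cores -/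

namespace ColoredTrees

section Core

variable {Z : Type*} [MetricSpace Z] {U U' : Set Z} {ε ρ d : ℝ} {x y z : Z}

lemma dist_lt_of_mem_thickening (hU : ∀ a ∈ U, ∀ b ∈ U, dist a b ≤ d)
    (hx : x ∈ Metric.thickening ε U) (hy : y ∈ Metric.thickening ε U) : dist x y < d + 2 * ε := by
  obtain ⟨a, ha, hxa⟩ := Metric.mem_thickening_iff.1 hx
  obtain ⟨b, hb, hyb⟩ := Metric.mem_thickening_iff.1 hy
  linarith [hU a ha b hb, dist_triangle4_right x y a b]

lemma disjoint_thickening (h : ∀ a ∈ U, ∀ b ∈ U', ε + ρ ≤ dist a b) :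
    Disjoint (Metric.thickening ε U) (Metric.thickening ρ U') := by
  refine Set.disjoint_left.2 fun x hx hx' => ?_
  obtain ⟨a, ha, hxa⟩ := Metric.mem_thickening_iff.1 hx
  obtain ⟨b, hb, hxb⟩ := Metric.mem_thickening_iff.1 hx'
  linarith [h a ha b hb, dist_triangle_left a b x]

/-- The `ε`-core of `U`: the points at distance more than `ε` from the complement of `U`. -/
def core (ε : ℝ) (U : Set Z) : Set Z := (Metric.cthickening ε Uᶜ)ᶜ

lemma isOpen_core : IsOpen (core ε U) := Metric.isClosed_cthickening.isOpen_compl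

lemma core_subset : core ε U ⊆ U :=
  Set.compl_subset_comm.1 (Metric.self_subset_cthickening Uᶜ)

lemma lt_dist_of_mem_core (hx : x ∈ core ε U) (hy : y ∉ U) : ε < dist x y :=
  not_le.1 fun h => hx (Metric.mem_cthickening_of_dist_le x y ε Uᶜ hy h)

lemma ball_subset_core (hε : 0 ≤ ε)
    (hz : ENNReal.ofReal (ρ + ε) < Metric.infEDist z Uᶜ) : Metric.ball z ρ ⊆ core ε U := by
  intro y hy hyU
  have hz' : z ∈ Metric.thickening ρ (Metric.cthickening ε Uᶜ) :=
    Metric.mem_thickening_iff.2 ⟨y, hyU, Metric.mem_ball'.1 hy⟩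
  exact hz.not_gt (Metric.thickening_cthickening_subset ρ hε Uᶜ hz')

/-- The nonempty `ε`-cores of the members of a family. -/
def coreFamily (ε : ℝ) (𝒱 : Set (Set Z)) : Set (Set Z) := core ε '' 𝒱 \ {∅}

end Core

/-! ### Existence of adapted sequences -/

section Saturation

variable {Z : Type*} [MetricSpace Z]

/-- Two points are linked by the indices in `I` if they lie in the `5 r ^ (i + 1)`-neighborhood of a
common member of `W i` for some `i ∈ I`. This neighborhood is wide enough to contain `B(U)` for the
set `U` that is built from that member, see `WellSpaced.hull_saturation_subset`. -/
def Link (W : ℕ → Set (Set Z)) (r : ℝ) (I : Set ℕ) (x y : Z) : Prop :=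
  ∃ i ∈ I, ∃ V ∈ W i, x ∈ Metric.thickening (5 * r ^ (i + 1)) V ∧
    y ∈ Metric.thickening (5 * r ^ (i + 1)) V

/-- Two points are chained by the indices in `I` if a finite sequence of links connects them. -/
abbrev Chained (W : ℕ → Set (Set Z)) (r : ℝ) (I : Set ℕ) : Z → Z → Prop :=
  Relation.ReflTransGen (Link W r I)

/-- The saturation of a set `U` of index `j`: the points chained to `U` by indices above `j`. It
swallows every member of larger index whose neighborhood it meets. -/
def saturation (W : ℕ → Set (Set Z)) (r : ℝ) (j : ℕ) (U : Set Z) : Set Z :=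
  {y | ∃ x ∈ U, Chained W r (Set.Ici (j + 1)) x y}

/-- Members of `W j` have small diameter relative to `r ^ j` and are far apart relative to
`r ^ (j + 1)`. The diameters of the members of index `0` are not restricted, since `Z` itself will
be one of them. -/
structure WellSpaced (W : ℕ → Set (Set Z)) (r : ℝ) : Prop where
  pos : 0 < r
  le : r ≤ 1 / 24
  dist_le : ∀ j, ∀ V ∈ W (j + 1), ∀ x ∈ V, ∀ y ∈ V, dist x y ≤ r ^ (j + 1) / 2
  gap : ∀ j, (W j).Pairwise fun V V' => ∀ x ∈ V, ∀ y ∈ V', 11 * r ^ (j + 1) ≤ dist x y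

variable {W : ℕ → Set (Set Z)} {r : ℝ} {I J : Set ℕ} {i j M : ℕ} {U V V' : Set Z} {x y : Z}

lemma Chained.mono (hIJ : I ⊆ J) (h : Chained W r I x y) : Chained W r J x y :=
  Relation.ReflTransGen.mono (fun _ _ ⟨i, hi, hV⟩ => ⟨i, hIJ hi, hV⟩) _ _ h

lemma Chained.exists_Ico (h : Chained W r (Set.Ici j) x y) :
    ∃ M, Chained W r (Set.Ico j M) x y := by
  induction h with
  | refl => exact ⟨0, .refl⟩
  | tail _ hlink ih =>
    obtain ⟨M, hM⟩ := ih
    obtain ⟨i, hi, hV⟩ := hlink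
    exact ⟨max M (i + 1), (hM.mono (Set.Ico_subset_Ico_right (le_max_left _ _))).tail
      ⟨i, ⟨hi, lt_max_of_lt_right i.lt_succ_self⟩, hV⟩⟩

lemma Link.eq_index_or_succ (h : Link W r (Set.Ico j M) x y) :
    (∃ V ∈ W j, x ∈ Metric.thickening (5 * r ^ (j + 1)) V ∧
      y ∈ Metric.thickening (5 * r ^ (j + 1)) V) ∨ Link W r (Set.Ico (j + 1) M) x y := by
  obtain ⟨i, ⟨hji, hiM⟩, hV⟩ := h
  rcases hji.eq_or_lt with rfl | hlt
  · exact .inl hV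
  · exact .inr ⟨i, ⟨hlt, hiM⟩, hV⟩

lemma subset_saturation (j : ℕ) (U : Set Z) : U ⊆ saturation W r j U :=
  fun x hx => ⟨x, hx, .refl⟩

lemma thickening_subset_saturation (hij : j < i) (hV : V ∈ W i)
    (h : (Metric.thickening (5 * r ^ (i + 1)) V ∩ saturation W r j U).Nonempty) :
    Metric.thickening (5 * r ^ (i + 1)) V ⊆ saturation W r j U := by
  obtain ⟨y, hy, x, hx, hxy⟩ := h
  exact fun z hz => ⟨x, hx, hxy.tail ⟨i, hij, V, hV, hy, hz⟩⟩

lemma isOpen_saturation (hU : IsOpen U) : IsOpen (saturation W r j U) := by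
  refine isOpen_iff_mem_nhds.2 ?_
  rintro y ⟨x, hx, hxy⟩
  rcases hxy.cases_tail with rfl | ⟨z, hxz, i, hi, V, hV, hz, hy⟩
  · exact Filter.mem_of_superset (hU.mem_nhds hx) (subset_saturation j U)
  · exact Filter.mem_of_superset (Metric.isOpen_thickening.mem_nhds hy)
      (thickening_subset_saturation hi hV ⟨z, hz, x, hx, hxz⟩)

namespace WellSpaced

lemma disjoint_thickening (hW : WellSpaced W r) (hV : V ∈ W j) (hV' : V' ∈ W j) (hne : V ≠ V') :
    Disjoint (Metric.thickening (5 * r ^ (j + 1)) V) (Metric.thickening (6 * r ^ (j + 1)) V') :=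
  ColoredTrees.disjoint_thickening fun a ha b hb => by linarith [hW.gap j hV hV' hne a ha b hb]

lemma eq_of_dist_lt (hW : WellSpaced W r) (hV : V ∈ W j) (hV' : V' ∈ W j)
    (hx : x ∈ Metric.thickening (5 * r ^ (j + 1)) V)
    (hy : y ∈ Metric.thickening (5 * r ^ (j + 1)) V') (hxy : dist x y < r ^ (j + 1)) : V = V' := by
  by_contra hne
  have hx' : x ∈ Metric.thickening (r ^ (j + 1) + 5 * r ^ (j + 1)) V' :=
    Metric.thickening_thickening_subset _ _ _ (Metric.mem_thickening_iff.2 ⟨y, hy, hxy⟩)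
  rw [← one_add_mul] at hx'
  norm_num at hx'
  exact Set.disjoint_left.1 (hW.disjoint_thickening hV hV' hne) hx hx'

/-- As the connecting chains of larger index are too short to reach another member of `W j`, all
links of index `j` in a chain come from one member. -/
lemma chained_Ico_cases (hW : WellSpaced W r)
    (hshort : ∀ x y, Chained W r (Set.Ico (j + 1) M) x y → dist x y < r ^ (j + 1))
    (h : Chained W r (Set.Ico j M) x y) :
    Chained W r (Set.Ico (j + 1) M) x y ∨
      ∃ V ∈ W j, ∃ x' ∈ Metric.thickening (5 * r ^ (j + 1)) V,
        ∃ y' ∈ Metric.thickening (5 * r ^ (j + 1)) V,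
        Chained W r (Set.Ico (j + 1) M) x x' ∧ Chained W r (Set.Ico (j + 1) M) y' y := by
  induction h with
  | refl => exact .inl .refl
  | @tail b c _ hlink ih =>
    rcases hlink.eq_index_or_succ with ⟨V', hV', hb, hc⟩ | hlink
    · rcases ih with hxb | ⟨V, hV, x', hx', y', hy', hxx', hyb⟩
      · exact .inr ⟨V', hV', b, hb, c, hc, hxb, .refl⟩
      · obtain rfl := hW.eq_of_dist_lt hV hV' hy' hb (hshort _ _ hyb)
        exact .inr ⟨V, hV, x', hx', c, hc, hxx', .refl⟩
    · rcases ih with hxb | ⟨V, hV, x', hx', y', hy', hxx', hyb⟩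
      · exact .inl (hxb.tail hlink)
      · exact .inr ⟨V, hV, x', hx', y', hy', hxx', hyb.tail hlink⟩

lemma dist_lt_of_chained_Ico (hW : WellSpaced W r)
    (h : Chained W r (Set.Ico (j + 1) M) x y) : dist x y < r ^ (j + 1) := by
  have hpos : 0 < r ^ (j + 1) := pow_pos hW.pos _
  induction hd : M - (j + 1) generalizing j x y with
  | zero =>
    rcases h.cases_tail with rfl | ⟨_, _, i, ⟨hji, hiM⟩, -⟩
    · rwa [dist_self]
    · omega
  | succ d ih =>
    have hshort : ∀ x y, Chained W r (Set.Ico (j + 1 + 1) M) x y → dist x y < r ^ (j + 1 + 1) :=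
      fun x y hxy => ih hxy (pow_pos hW.pos _) (by omega)
    have hsucc : r ^ (j + 1 + 1) ≤ r ^ (j + 1) / 24 := by
      rw [pow_succ]
      nlinarith [hW.le]
    rcases hW.chained_Ico_cases hshort h with h | ⟨V, hV, x', hx', y', hy', hxx', hyy'⟩
    · linarith [hshort _ _ h]
    · have hx'y' := dist_lt_of_mem_thickening (hW.dist_le j V hV) hx' hy'
      linarith [hshort _ _ hxx', hshort _ _ hyy', dist_triangle4 x x' y' y]

lemma saturation_subset_thickening (hW : WellSpaced W r) (j : ℕ) (U : Set Z) :
    saturation W r j U ⊆ Metric.thickening (r ^ (j + 1)) U := by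
  rintro y ⟨x, hx, hxy⟩
  obtain ⟨M, hM⟩ := hxy.exists_Ico
  exact Metric.mem_thickening_iff.2 ⟨x, hx, dist_comm x y ▸ hW.dist_lt_of_chained_Ico hM⟩

lemma dist_saturation_lt (hW : WellSpaced W r) (hU : U ∈ W (j + 1))
    (hx : x ∈ saturation W r (j + 1) U) (hy : y ∈ saturation W r (j + 1) U) :
    dist x y < r ^ (j + 1) / 2 + 2 * r ^ (j + 1 + 1) :=
  dist_lt_of_mem_thickening (hW.dist_le j U hU) (hW.saturation_subset_thickening _ U hx)
    (hW.saturation_subset_thickening _ U hy)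

lemma disjoint_thickening_saturation (hW : WellSpaced W r) (hV : V ∈ W j) (hV' : V' ∈ W j)
    (hne : V ≠ V') :
    Disjoint (Metric.thickening (5 * r ^ (j + 1)) V) (saturation W r j V') := by
  have hpos : 0 < r ^ (j + 1) := pow_pos hW.pos _
  exact (hW.disjoint_thickening hV hV' hne).mono_right
    ((hW.saturation_subset_thickening j V').trans (Metric.thickening_mono (by linarith) V'))

lemma disjoint_saturation (hW : WellSpaced W r) (hV : V ∈ W j) (hV' : V' ∈ W j) (hne : V ≠ V') :
    Disjoint (saturation W r j V) (saturation W r j V') := by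
  have hpos : 0 < r ^ (j + 1) := pow_pos hW.pos _
  exact (hW.disjoint_thickening_saturation hV hV' hne).mono_left
    ((hW.saturation_subset_thickening j V).trans (Metric.thickening_mono (by linarith) V))

lemma hull_saturation_subset (hW : WellSpaced W r) (X : HypApprox Z r) (j : ℕ) (U : Set Z) :
    hull X j (saturation W r j U) ⊆ Metric.thickening (5 * r ^ (j + 1)) U := by
  refine Set.iUnion₂_subset ?_
  rintro v ⟨hv, q, hqv, hq⟩ p hpv
  obtain ⟨x, hx, hqx⟩ := Metric.mem_thickening_iff.1 (hW.saturation_subset_thickening j U hq)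
  have hradius : r ^ v.level = r ^ (j + 1) := by rw [hv, ← zpow_natCast, Nat.cast_succ]
  rw [HypApprox.Vertex.ball, Metric.mem_ball, hradius] at hqv hpv
  refine Metric.mem_thickening_iff.2 ⟨x, hx, ?_⟩
  linarith [dist_triangle p q x, dist_triangle_right p q v.center]

end WellSpaced

end Saturation

section Existence

variable {Z C : Type*} [MetricSpace Z] {W : ℕ → C → Set (Set Z)} {r δ : ℝ}

/-- Families of nonempty open sets, well spaced in each color and covering `Z` with a Lebesgue
number suited to `B(v)`, whose saturations form an adapted sequence of coverings. -/
structure IsSeed (W : ℕ → C → Set (Set Z)) (r : ℝ) : Prop where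
  wellSpaced : ∀ c, WellSpaced (fun j => W j c) r
  zero : ∀ c, W 0 c = {Set.univ}
  isOpen : ∀ j c, ∀ V ∈ W j c, IsOpen V
  nonempty : ∀ j c, ∀ V ∈ W j c, V.Nonempty
  exists_ball_subset : ∀ j z, ∃ c, ∃ V ∈ W j c, Metric.ball z (2 * r ^ (j + 1)) ⊆ V

namespace IsSeed

/-- The sequence of coverings by the saturations of the members of a seed. -/
def coverSeq (hW : IsSeed W r) : CoverSeq Z C where
  family j c := saturation (fun i => W i c) r j '' W j c
  isCover j :=
    { isOpen := by
        rintro c _ ⟨V, hV, rfl⟩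
        exact isOpen_saturation (hW.isOpen j c V hV)
      disjoint := by
        rintro c _ ⟨V, hV, rfl⟩ _ ⟨V', hV', rfl⟩ hne
        exact (hW.wellSpaced c).disjoint_saturation hV hV' (ne_of_apply_ne _ hne)
      covers := fun z => by
        obtain ⟨c, V, hV, hz⟩ := hW.exists_ball_subset j z
        have hr : 0 < r := (hW.wellSpaced c).pos
        exact ⟨c, _, ⟨V, hV, rfl⟩,
          subset_saturation j V (hz (Metric.mem_ball_self (by positivity)))⟩ }
  nonempty := by
    rintro j c _ ⟨V, hV, rfl⟩
    exact (hW.nonempty j c V hV).mono (subset_saturation j V)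
  zero c := by
    rw [hW.zero, Set.image_singleton, Set.univ_subset_iff.1 (subset_saturation 0 Set.univ)]

lemma mesh_coverSeq_lt [Nonempty C] (hW : IsSeed W r) (j : ℕ) :
    mesh (hW.coverSeq.family (j + 1)) < ENNReal.ofReal (r ^ (j + 1)) := by
  have hW' := hW.wellSpaced (Classical.arbitrary C)
  have hpos : 0 < r ^ (j + 1) := pow_pos hW'.pos _
  have hlt : r ^ (j + 1) / 2 + 2 * r ^ (j + 1 + 1) < r ^ (j + 1) := by
    rw [pow_succ r (j + 1)]
    nlinarith [hW'.le]
  refine lt_of_le_of_lt (iSup_le fun c => iSup₂_le ?_) ((ENNReal.ofReal_lt_ofReal_iff hpos).2 hlt)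
  rintro _ ⟨V, hV, rfl⟩
  refine Metric.ediam_le fun x hx y hy => ?_
  rw [edist_dist]
  exact ENNReal.ofReal_le_ofReal ((hW.wellSpaced c).dist_saturation_lt hV hx hy).le

lemma separation_coverSeq (hW : IsSeed W r) (X : HypApprox Z r) {c : C} {j j' : ℕ}
    (hj : j' ≤ j) {U U' : Set Z} (hU : U ∈ hW.coverSeq.family j c)
    (hU' : U' ∈ hW.coverSeq.family j' c) (hne : (j, U) ≠ (j', U')) :
    hull X j U ⊆ U' ∨ Disjoint (hull X j U) U' := by
  obtain ⟨V, hV, rfl⟩ := hU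
  obtain ⟨V', hV', rfl⟩ := hU'
  have hhull := (hW.wellSpaced c).hull_saturation_subset X j V
  rcases hj.eq_or_lt with rfl | hlt
  · have hVV' : V ≠ V' := fun h => hne (by rw [h])
    exact .inr (((hW.wellSpaced c).disjoint_thickening_saturation hV hV' hVV').mono_left hhull)
  · refine (Set.disjoint_or_nonempty_inter (Metric.thickening (5 * r ^ (j + 1)) V) _).symm.imp
      (fun hmeet => ?_) fun hdisj => hdisj.mono_left hhull
    exact hhull.trans (thickening_subset_saturation (W := fun i => W i c) hlt hV hmeet)

lemma adapted_coverSeq [Nonempty C] (hW : IsSeed W r) (X : HypApprox Z r) :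
    hW.coverSeq.Adapted X where
  mesh_lt j hj := by
    obtain ⟨i, rfl⟩ := Nat.exists_eq_add_of_le' hj
    exact hW.mesh_coverSeq_lt i
  ball_subset j v hv := by
    obtain ⟨c, V, hV, hvV⟩ := hW.exists_ball_subset j v.center
    refine ⟨c, _, ⟨V, hV, rfl⟩, Set.Subset.trans ?_ (subset_saturation j V)⟩
    rwa [HypApprox.Vertex.ball, hv, ← Nat.cast_succ, zpow_natCast]
  separation _ _ _ hj _ hU _ hU' hne := hW.separation_coverSeq X hj hU hU' hne

end IsSeed

lemma lt_dist_of_mem_coreFamily {ε : ℝ} {𝒱 : Set (Set Z)} (h𝒱 : 𝒱.PairwiseDisjoint id) :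
    (coreFamily ε 𝒱).Pairwise fun V V' => ∀ x ∈ V, ∀ y ∈ V', ε < dist x y := by
  rintro _ ⟨⟨U, hU, rfl⟩, -⟩ _ ⟨⟨U', hU', rfl⟩, -⟩ hne x hx y hy
  have hdisj : Disjoint U U' := h𝒱 hU hU' (ne_of_apply_ne _ hne)
  exact lt_dist_of_mem_core hx (Set.disjoint_right.1 hdisj (core_subset hy))

lemma edist_le_mesh {𝒰 : C → Set (Set Z)} {c : C} {U : Set Z} {x y : Z} (hU : U ∈ 𝒰 c)
    (hx : x ∈ U) (hy : y ∈ U) : edist x y ≤ mesh 𝒰 :=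
  (Metric.edist_le_ediam_of_mem hx hy).trans (le_iSup_of_le c (le_iSup₂_of_le U hU le_rfl))

lemma exists_ball_subset_core {𝒰 : C → Set (Set Z)} {ε ρ : ℝ} (hε : 0 ≤ ε) (hρ : 0 < ρ)
    (hL : ENNReal.ofReal (ρ + ε) < lebesgue 𝒰) (z : Z) :
    ∃ c, ∃ V ∈ coreFamily ε (𝒰 c), Metric.ball z ρ ⊆ V := by
  have hz : ENNReal.ofReal (ρ + ε) < ⨆ c, ⨆ U ∈ 𝒰 c, Metric.infEDist z Uᶜ :=
    hL.trans_le ((iInf_le _ z).trans (min_le_left _ _))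
  simp only [lt_iSup_iff] at hz
  obtain ⟨c, U, hU, hzU⟩ := hz
  have hball := ball_subset_core hε hzU
  have hne : (core ε U).Nonempty := ⟨z, hball (Metric.mem_ball_self hρ)⟩
  exact ⟨c, core ε U, ⟨⟨U, hU, rfl⟩, hne.ne_empty⟩, hball⟩

/-- `Z` alone at index `0` and, at index `j + 1`, the cores of the members of the `j`-th covering.
The depth of the cores is the gap that `WellSpaced` asks for. -/
def seed (𝒰 : ℕ → C → Set (Set Z)) (r : ℝ) : ℕ → C → Set (Set Z)
  | 0, _ => {Set.univ}
  | j + 1, c => coreFamily (11 * r ^ (j + 1 + 1)) (𝒰 j c)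

lemma wellSpaced_seed {𝒰 : ℕ → C → Set (Set Z)} (hr : 0 < r) (hr' : r ≤ 1 / 24)
    (h𝒰 : ∀ j, IsColoredCover (𝒰 j))
    (hmesh : ∀ j, mesh (𝒰 j) ≤ ENNReal.ofReal (r ^ (j + 1) / 2)) (c : C) :
    WellSpaced (fun j => seed 𝒰 r j c) r where
  pos := hr
  le := hr'
  dist_le := by
    rintro j _ ⟨⟨U, hU, rfl⟩, -⟩ x hx y hy
    rw [← ENNReal.ofReal_le_ofReal_iff (by positivity), ← edist_dist]
    exact (edist_le_mesh hU (core_subset hx) (core_subset hy)).trans (hmesh j)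
  gap
    | 0 => Set.pairwise_singleton _ _
    | j + 1 => (lt_dist_of_mem_coreFamily ((h𝒰 j).disjoint c)).mono' fun _ _ h x hx y hy =>
        (h x hx y hy).le

lemma isSeed_seed [Nonempty Z] [Nonempty C] {𝒰 : ℕ → C → Set (Set Z)} (hr : 0 < r)
    (hr' : r ≤ 1 / 24) (hδ : 26 * r < δ) (h𝒰 : ∀ j, IsColoredCover (𝒰 j))
    (hmesh : ∀ j, mesh (𝒰 j) ≤ ENNReal.ofReal (r ^ (j + 1) / 2))
    (hL : ∀ j, ENNReal.ofReal (δ * (r ^ (j + 1) / 2)) ≤ lebesgue (𝒰 j)) :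
    IsSeed (seed 𝒰 r) r where
  wellSpaced := wellSpaced_seed hr hr' h𝒰 hmesh
  zero _ := rfl
  isOpen
    | 0, _, _, rfl => isOpen_univ
    | _ + 1, _, _, ⟨⟨_, _, rfl⟩, _⟩ => isOpen_core
  nonempty
    | 0, _, _, rfl => Set.univ_nonempty
    | _ + 1, _, _, ⟨_, hV⟩ => Set.nonempty_iff_ne_empty.2 hV
  exists_ball_subset
    | 0, _ => ⟨Classical.arbitrary C, Set.univ, rfl, Set.subset_univ _⟩
    | j + 1, z => by
      refine exists_ball_subset_core (by positivity) (by positivity) (lt_of_lt_of_le ?_ (hL j)) z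
      rw [ENNReal.ofReal_lt_ofReal_iff_of_nonneg (by positivity), pow_succ]
      nlinarith [pow_pos hr (j + 1)]

lemma CapDimProperty.exists_adapted [Nonempty Z] {n : ℕ} (h : CapDimProperty Z n) :
    ∃ r₀ : ℝ, 0 < r₀ ∧ ∀ r : ℝ, 0 < r → r < r₀ →
      ∃ 𝒰 : CoverSeq Z (Fin (n + 1)), ∀ X : HypApprox Z r, 𝒰.Adapted X := by
  obtain ⟨δ, hδ, τ₀, hτ₀, hcov⟩ := h
  refine ⟨min (1 / 24) (min τ₀ (δ / 26)), by positivity, fun r hr hr₀ => ?_⟩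
  obtain ⟨hr24, hrτ₀, hrδ⟩ : r < 1 / 24 ∧ r < τ₀ ∧ r < δ / 26 := by
    simpa only [lt_min_iff] using hr₀
  have hscale : ∀ j : ℕ, r ^ (j + 1) / 2 < τ₀ := fun j => by
    have hle : r ^ (j + 1) ≤ r := pow_le_of_le_one hr.le (by linarith) j.succ_ne_zero
    linarith
  choose 𝒰 h𝒰 hmesh hL using fun j : ℕ => hcov (r ^ (j + 1) / 2) (by positivity) (hscale j)
  have hseed : IsSeed (seed 𝒰 r) r := isSeed_seed hr hr24.le (by linarith) h𝒰 hmesh hL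
  exact ⟨hseed.coverSeq, hseed.adapted_coverSeq⟩

end Existence

end ColoredTrees

/-! ### Hyperbolic approximations -/

namespace ColoredTrees.HypApprox

variable {Z : Type*} [MetricSpace Z] {r : ℝ} {X : HypApprox Z r}

lemma k₀_nonpos (h : r ≤ Metric.diam (Set.univ : Set Z)) : X.k₀ ≤ 0 := by
  have hdiam : Metric.diam (Set.univ : Set Z) < r ^ X.k₀ := X.isGreatest.1
  by_contra! hpos
  have hle : r ^ X.k₀ ≤ r ^ (1 : ℤ) :=
    zpow_le_zpow_right_of_le_one₀ X.pos (by linarith [X.le_sixth]) hpos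
  rw [zpow_one] at hle
  linarith

lemma neg_one_le_k₀ (h₀ : 0 < Metric.diam (Set.univ : Set Z))
    (h : r < 1 / Metric.diam (Set.univ : Set Z)) : -1 ≤ X.k₀ := by
  refine X.isGreatest.2 (Set.mem_ofPred.2 ?_)
  rw [zpow_neg_one, ← one_div]
  exact (lt_one_div X.pos h₀).1 h

namespace Vertex

variable {v w : X.Vertex}

lemma ext (h : v.level = w.level) (h' : v.center = w.center) : v = w :=
  Subtype.ext (Prod.ext h h')

lemma k₀_le (v : X.Vertex) : X.k₀ ≤ v.level := v.2.1

lemma radius_pos (v : X.Vertex) : 0 < r ^ v.level := zpow_pos X.pos _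

lemma center_mem_ball (v : X.Vertex) : v.center ∈ v.ball :=
  Metric.mem_ball_self (by linarith [v.radius_pos])

lemma eq_of_dist_lt (h : v.level = w.level) (hd : dist v.center w.center < r ^ w.level) :
    v = w := by
  refine ext h ?_
  by_contra hne
  have hv : v.center ∈ X.V w.level := h ▸ v.2.2
  exact hd.not_ge ((X.maximal _ w.k₀_le).prop hv w.2.2 hne)

lemma eq_of_level_eq_k₀ [BoundedSpace Z] (hv : v.level = X.k₀) (hw : w.level = X.k₀) : v = w := by
  refine eq_of_dist_lt (hv.trans hw.symm) ?_
  rw [hw]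
  exact (Metric.dist_le_diam_of_mem (Bornology.IsBounded.all _) (Set.mem_univ _)
    (Set.mem_univ _)).trans_lt X.isGreatest.1

end Vertex

lemma exists_vertex_near (X : HypApprox Z r) {k : ℤ} (hk : X.k₀ ≤ k) (z : Z) :
    ∃ v : X.Vertex, v.level = k ∧ dist z v.center < r ^ k := by
  by_contra! hcon
  have hfar : ∀ y ∈ X.V k, r ^ k ≤ dist z y := fun y hy => hcon ⟨(k, y), hk, hy⟩ rfl
  have hsep : IsSeparatedBy (r ^ k) (insert z (X.V k)) :=
    (X.maximal k hk).prop.insert fun y hy _ => ⟨hfar y hy, dist_comm z y ▸ hfar y hy⟩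
  have hz : z ∈ X.V k :=
    (X.maximal k hk).le_of_ge hsep (Set.subset_insert _ _) (Set.mem_insert _ _)
  exact (zpow_pos X.pos k).not_ge (dist_self z ▸ hfar z hz)

section Edges

variable {u u' v w : X.Vertex}

lemma Horizontal.symm (h : Horizontal v w) : Horizontal w v :=
  ⟨h.1.symm, h.2.1.symm, by rw [Set.inter_comm]; exact h.2.2⟩

lemma Horizontal.adj (h : Horizontal v w) : X.graph.Adj v w := Or.inl h

lemma Radial.adj (h : Radial v w) : X.graph.Adj v w := Or.inr (Or.inl h)

lemma Horizontal.k₀_lt [BoundedSpace Z] (h : Horizontal v w) : X.k₀ < v.level :=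
  lt_of_le_of_ne v.k₀_le fun hv => h.1 (Vertex.eq_of_level_eq_k₀ hv.symm (h.2.1 ▸ hv.symm))

lemma Horizontal.dist_le (h : Horizontal v w) : dist w.center v.center ≤ 4 * r ^ v.level := by
  obtain ⟨-, hl, z, hv, hw⟩ := h
  rw [Vertex.closedBall, Metric.mem_closedBall] at hv hw
  rw [← hl, dist_comm] at hw
  linarith [dist_triangle w.center z v.center]

lemma horizontal_of_mem_ball {z : Z} (hl : u.level = u'.level) (hz : z ∈ u.ball)
    (hz' : z ∈ u'.ball) : u = u' ∨ Horizontal u u' :=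
  (eq_or_ne u u').imp_right fun hne =>
    ⟨hne, hl, z, Metric.ball_subset_closedBall hz, Metric.ball_subset_closedBall hz'⟩

lemma radial_of_dist_le (hl : v.level = u.level + 1)
    (hd : dist v.center u.center ≤ r ^ u.level + 4 * r ^ v.level) : Radial u v := by
  refine ⟨hl, Metric.ball_subset_ball' ?_⟩
  have hle : r ^ v.level ≤ r ^ u.level / 6 := by
    rw [hl, zpow_add_one₀ X.pos.ne']
    nlinarith [u.radius_pos, X.le_sixth]
  linarith

lemma Radial.eq_or_horizontal (h : Radial u v) (h' : Radial u' v) : u = u' ∨ Horizontal u u' :=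
  horizontal_of_mem_ball (add_right_cancel (h.1.symm.trans h'.1)) (h.2 v.center_mem_ball)
    (h'.2 v.center_mem_ball)

lemma exists_radial_forall_horizontal (hv : X.k₀ < v.level) :
    ∃ u, Radial u v ∧ ∀ w, Horizontal v w → Radial u w := by
  obtain ⟨u, hu, hd⟩ := X.exists_vertex_near (k := v.level - 1) (by omega) v.center
  rw [← hu] at hd
  refine ⟨u, radial_of_dist_le (by omega) (by linarith [v.radius_pos]), fun w hw => ?_⟩
  refine radial_of_dist_le (hw.2.1 ▸ by omega) ?_
  rw [← hw.2.1]
  linarith [hw.dist_le, dist_triangle w.center v.center u.center]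

end Edges

/-- `Descent a v x`: the vertex `x` is reached from `v` by `a` radial edges towards the root. -/
inductive Descent : ℕ → X.Vertex → X.Vertex → Prop
  | nil (v : X.Vertex) : Descent 0 v v
  | snoc {a : ℕ} {v x y : X.Vertex} (h : Descent a v x) (hy : Radial y x) : Descent (a + 1) v y

lemma Descent.ball_subset {a : ℕ} {v x : X.Vertex} (h : Descent a v x) : v.ball ⊆ x.ball := by
  induction h with
  | nil v => exact subset_rfl
  | snoc _ hy ih => exact ih.trans hy.2

lemma Descent.exists_walk {a : ℕ} {v x : X.Vertex} (h : Descent a v x) :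
    ∃ p : X.graph.Walk v x, p.length = a := by
  induction h with
  | nil v => exact ⟨.nil, rfl⟩
  | snoc _ hy ih =>
    obtain ⟨p, rfl⟩ := ih
    exact ⟨p.concat hy.adj.symm, p.length_concat _⟩

lemma Descent.of_dist_lt {a : ℕ} {v u : X.Vertex} (hl : v.level = u.level + a)
    (hd : dist v.center u.center < r ^ u.level) : Descent a v u := by
  induction a generalizing u with
  | zero =>
    obtain rfl := Vertex.eq_of_dist_lt (by simpa only [Nat.cast_zero, add_zero] using hl) hd
    exact .nil _
  | succ a ih =>
    have hu := u.k₀_le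
    obtain ⟨w, hw, hdw⟩ := X.exists_vertex_near (k := u.level + 1) (by omega) v.center
    rw [← hw] at hdw
    refine (ih (by push_cast at hl; omega) hdw).snoc (radial_of_dist_le hw ?_)
    linarith [w.radius_pos, dist_triangle_left w.center u.center v.center]

lemma Vertex.exists_descent (v : X.Vertex) {k : ℤ} (hk : X.k₀ ≤ k) (hkv : k ≤ v.level) :
    ∃ u : X.Vertex, u.level = k ∧ dist v.center u.center < r ^ k ∧
      Descent (v.level - k).toNat v u := by
  obtain ⟨u, hu, hd⟩ := X.exists_vertex_near hk v.center
  exact ⟨u, hu, hd, .of_dist_lt (by omega) (by rwa [hu])⟩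

lemma graph_connected [BoundedSpace Z] [Nonempty Z] (X : HypApprox Z r) : X.graph.Connected := by
  obtain ⟨o, ho, -⟩ := X.exists_vertex_near le_rfl (Classical.arbitrary Z)
  have hroot : ∀ v : X.Vertex, X.graph.Reachable v o := fun v => by
    obtain ⟨u, hu, -, hvu⟩ := v.exists_descent le_rfl v.k₀_le
    obtain rfl := Vertex.eq_of_level_eq_k₀ hu ho
    obtain ⟨p, -⟩ := hvu.exists_walk
    exact ⟨p⟩
  exact { preconnected := fun v w => (hroot v).trans (hroot w).symm, nonempty := ⟨o⟩ }

lemma graph_dist_le {v w : X.Vertex} {k : ℤ} (hk : X.k₀ ≤ k) (hkv : k ≤ v.level)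
    (hkw : k ≤ w.level) (hd : dist v.center w.center ≤ r ^ k) :
    (X.graph.dist v w : ℤ) ≤ v.level + w.level - 2 * k + 1 := by
  obtain ⟨x, hx, hdx, hvx⟩ := v.exists_descent hk hkv
  obtain ⟨y, hy, hdy, hwy⟩ := w.exists_descent hk hkw
  obtain ⟨p, hp⟩ := hvx.exists_walk
  obtain ⟨q, hq⟩ := hwy.exists_walk
  have hpos : 0 < r ^ k := zpow_pos X.pos k
  have hmem : v.center ∈ x.ball := by
    rw [Vertex.ball, Metric.mem_ball, hx]
    linarith
  have hmem' : v.center ∈ y.ball := by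
    rw [Vertex.ball, Metric.mem_ball, hy]
    linarith [dist_triangle v.center w.center y.center]
  rcases horizontal_of_mem_ball (hx.trans hy.symm) hmem hmem' with rfl | hxy
  · have hlen := SimpleGraph.dist_le (p.append q.reverse)
    rw [SimpleGraph.Walk.length_append, SimpleGraph.Walk.length_reverse, hp, hq] at hlen
    omega
  · have hlen := SimpleGraph.dist_le (p.append (.cons hxy.adj q.reverse))
    rw [SimpleGraph.Walk.length_append, SimpleGraph.Walk.length_cons,
      SimpleGraph.Walk.length_reverse, hp, hq] at hlen
    omega

/-- `ValleyPath v w N`: there is a path of length `N` from `v` to `w` which first goes towards the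
root, then uses at most one horizontal edge, and then goes away from the root. -/
inductive ValleyPath : X.Vertex → X.Vertex → ℕ → Prop
  | descend {a : ℕ} {v x : X.Vertex} (h : Descent a v x) : ValleyPath v x a
  | across {a : ℕ} {v x y : X.Vertex} (h : Descent a v x) (hxy : Horizontal x y) :
      ValleyPath v y (a + 1)
  | ascend {N : ℕ} {v w w' : X.Vertex} (h : ValleyPath v w N) (hw : Radial w w') :
      ValleyPath v w' (N + 1)

namespace ValleyPath

variable [BoundedSpace Z] {v w w' : X.Vertex} {N : ℕ}

lemma exists_of_horizontal (h : ValleyPath v w N) (hw : Horizontal w w') :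
    ∃ N' ≤ N + 1, ValleyPath v w' N' := by
  induction h generalizing w' with
  | descend h => exact ⟨_, le_rfl, .across h hw⟩
  | across h hxy =>
    obtain ⟨u, -, hu⟩ := exists_radial_forall_horizontal hw.k₀_lt
    exact ⟨_, le_rfl, (descend (h.snoc (hu _ hxy.symm))).ascend (hu _ hw)⟩
  | ascend h hy ih =>
    obtain ⟨u, hu, hall⟩ := exists_radial_forall_horizontal hw.symm.k₀_lt
    rcases hy.eq_or_horizontal (hall _ hw.symm) with rfl | hyu
    · exact ⟨_, Nat.le_succ _, h.ascend hu⟩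
    · obtain ⟨N', hN', hpath⟩ := ih hyu
      exact ⟨N' + 1, by omega, hpath.ascend hu⟩

lemma exists_of_radial (h : ValleyPath v w N) (hw : Radial w' w) :
    ∃ N' ≤ N + 1, ValleyPath v w' N' := by
  cases h with
  | descend h => exact ⟨_, le_rfl, .descend (h.snoc hw)⟩
  | across h hxw =>
    obtain ⟨u, hu, hall⟩ := exists_radial_forall_horizontal hxw.k₀_lt
    rcases (hall _ hxw).eq_or_horizontal hw with rfl | huw'
    · exact ⟨_, Nat.le_succ _, .descend (h.snoc hu)⟩
    · exact ⟨_, le_rfl, .across (h.snoc hu) huw'⟩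
  | ascend h hu =>
    rcases hu.eq_or_horizontal hw with rfl | huw'
    · exact ⟨_, by omega, h⟩
    · obtain ⟨N', hN', hpath⟩ := h.exists_of_horizontal huw'
      exact ⟨N', by omega, hpath⟩

lemma exists_of_walk (p : X.graph.Walk w v) : ∃ N ≤ p.length, ValleyPath v w N := by
  induction p with
  | nil => exact ⟨0, le_rfl, .descend (.nil _)⟩
  | cons h p ih =>
    obtain ⟨N, hN, hpath⟩ := ih
    rw [SimpleGraph.Walk.length_cons]
    rcases h with h | h | h
    · obtain ⟨N', hN', hpath'⟩ := hpath.exists_of_horizontal h.symm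
      exact ⟨N', by omega, hpath'⟩
    · obtain ⟨N', hN', hpath'⟩ := hpath.exists_of_radial h
      exact ⟨N', by omega, hpath'⟩
    · exact ⟨N + 1, by omega, hpath.ascend h⟩

end ValleyPath

lemma exists_valleyPath [BoundedSpace Z] (v w : X.Vertex) :
    ∃ N ≤ X.graph.dist v w, ValleyPath v w N := by
  have : Nonempty Z := ⟨v.center⟩
  obtain ⟨p, hp⟩ := X.graph_connected.exists_walk_length_eq_dist w v
  rw [SimpleGraph.dist_comm, ← hp]
  exact ValleyPath.exists_of_walk p

end ColoredTrees.HypApprox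

/-! ### Colored trees -/

namespace ColoredTrees

section Graph

variable {V V' : Type*} {G : SimpleGraph V} {G' : SimpleGraph V'} {x y : V}

lemma isBridge_of_forall_mem_iff {S : Set V} (hx : x ∉ S) (hy : y ∈ S)
    (hS : ∀ a b, G.Adj a b → s(a, b) ≠ s(x, y) → (a ∈ S ↔ b ∈ S)) : G.IsBridge s(x, y) := by
  rw [SimpleGraph.isBridge_iff]
  rintro ⟨p⟩
  have hwalk : ∀ {a b}, (G.deleteEdges {s(x, y)}).Walk a b → (a ∈ S ↔ b ∈ S) := fun p => by
    induction p with
    | nil => rfl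
    | cons hab _ ih =>
      obtain ⟨hab, hne⟩ := SimpleGraph.deleteEdges_adj.1 hab
      exact (hS _ _ hab hne).trans ih
  exact hx ((hwalk p).2 hy)

lemma encard_symmDiff_le_length {α : Type*} {A : V → Set α}
    (hA : ∀ a b, G.Adj a b → (symmDiff (A a) (A b)).encard ≤ 1) (p : G.Walk x y) :
    (symmDiff (A x) (A y)).encard ≤ p.length := by
  induction p with
  | nil => simp
  | @cons x z y hxz p ih =>
    calc (symmDiff (A x) (A y)).encard
        ≤ (symmDiff (A x) (A z) ∪ symmDiff (A z) (A y)).encard :=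
          Set.encard_le_encard (symmDiff_triangle _ (A z) _)
      _ ≤ 1 + p.length := (Set.encard_union_le _ _).trans (add_le_add (hA x z hxz) ih)
      _ = (p.length + 1 : ℕ) := by rw [add_comm, Nat.cast_succ]

lemma dist_le_mul_dist_of_adj (hG : G.Connected) (hG' : G'.Connected) {f : V → V'} {K : ℕ}
    (hf : ∀ a b, G.Adj a b → G'.dist (f a) (f b) ≤ K) (x y : V) :
    G'.dist (f x) (f y) ≤ K * G.dist x y := by
  obtain ⟨p, hp⟩ := hG.exists_walk_length_eq_dist x y
  rw [← hp]
  clear hp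
  induction p with
  | nil => simp
  | cons hxz p ih =>
    rw [SimpleGraph.Walk.length_cons, mul_add_one, add_comm]
    exact hG'.dist_triangle.trans (add_le_add (hf _ _ hxz) ih)

end Graph

namespace CoverSeq

open HypApprox

variable {Z C : Type*} [MetricSpace Z] {𝒰 : CoverSeq Z C} {c : C} {r : ℝ} {X : HypApprox Z r}

section Tree

variable {a b p q u w : 𝒰.TreeVertex c}

namespace TreeVertex

lemma ext (h : u.level = w.level) (h' : u.set = w.set) : u = w :=
  Subtype.ext (Prod.ext h h')

lemma mem (u : 𝒰.TreeVertex c) : u.set ∈ 𝒰.family u.level c := u.2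

lemma set_nonempty (u : 𝒰.TreeVertex c) : u.set.Nonempty := 𝒰.nonempty _ _ _ u.mem

lemma eq_of_inter_nonempty (h : u.level = w.level) (h' : (u.set ∩ w.set).Nonempty) : u = w := by
  refine ext h ?_
  by_contra hne
  exact Set.not_disjoint_iff_nonempty_inter.2 h'
    ((𝒰.isCover w.level).disjoint c (h ▸ u.mem) w.mem hne)

end TreeVertex

variable (𝒰 c) in
/-- The root of `T_c`: the member `Z` of index `0`. -/
def root : 𝒰.TreeVertex c := ⟨(0, Set.univ), by rw [𝒰.zero]; rfl⟩

lemma TreeVertex.eq_root (h : u.level = 0) : u = 𝒰.root c :=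
  eq_of_inter_nonempty h (u.set_nonempty.mono fun _ hz => ⟨hz, Set.mem_univ _⟩)

lemma TreeVertex.exists_parent (h : u.level ≠ 0) : ∃ p, IsParent p u := by
  have hroot : IsAncestor (𝒰.root c) u := ⟨Nat.pos_of_ne_zero h, Set.subset_univ _⟩
  have hfin : (TreeVertex.level '' {a | IsAncestor a u}).Finite :=
    (Set.finite_Iio u.level).subset (Set.image_subset_iff.2 fun _ ha => ha.1)
  obtain ⟨_, ⟨p, hp, rfl⟩, hmax⟩ := Set.exists_max_image _ id hfin ⟨_, _, hroot, rfl⟩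
  exact ⟨p, hp, fun b hb => hmax _ ⟨b, hb, rfl⟩⟩

lemma IsAncestor.trans (h : IsAncestor a b) (h' : IsAncestor b u) : IsAncestor a u :=
  ⟨h.1.trans h'.1, h'.2.trans h.2⟩

lemma IsAncestor.ne (h : IsAncestor a u) : u ≠ a := fun heq => h.1.ne (by rw [heq])

lemma IsParent.adj (h : IsParent p u) : (𝒰.tree c).Adj p u := Or.inl h

lemma IsParent.unique (hp : IsParent p u) (hq : IsParent q u) : p = q := by
  obtain ⟨z, hz⟩ := u.set_nonempty
  exact TreeVertex.eq_of_inter_nonempty (le_antisymm (hq.2 p hp.1) (hp.2 q hq.1))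
    ⟨z, hp.1.2 hz, hq.1.2 hz⟩

lemma tree_connected (𝒰 : CoverSeq Z C) (c : C) : (𝒰.tree c).Connected := by
  have hroot : ∀ u : 𝒰.TreeVertex c, (𝒰.tree c).Reachable u (𝒰.root c) := fun u => by
    induction hl : u.level using Nat.strong_induction_on generalizing u with
    | _ l ih =>
      rcases eq_or_ne u.level 0 with h0 | h0
      · rw [TreeVertex.eq_root h0]
      · obtain ⟨p, hp⟩ := TreeVertex.exists_parent h0
        exact hp.adj.symm.reachable.trans (ih p.level (hl ▸ hp.1.1) p rfl)
  exact { preconnected := fun v w => (hroot v).trans (hroot w).symm, nonempty := ⟨𝒰.root c⟩ }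

/-- The ancestors of `u` together with `u` itself. -/
def ancestors (u : 𝒰.TreeVertex c) : Set (𝒰.TreeVertex c) := {a | a = u ∨ IsAncestor a u}

lemma level_le_of_mem_ancestors (h : a ∈ ancestors u) : a.level ≤ u.level := by
  rcases h with rfl | h
  exacts [le_rfl, h.1.le]

lemma set_subset_of_mem_ancestors (h : a ∈ ancestors u) : u.set ⊆ a.set := by
  rcases h with rfl | h
  exacts [subset_rfl, h.2]

lemma IsParent.notMem_ancestors (h : IsParent p u) : u ∉ ancestors p := fun hu =>
  h.1.1.not_ge (level_le_of_mem_ancestors hu)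

lemma subset_hull (hk : X.k₀ ≤ 0) (j : ℕ) (U : Set Z) : U ⊆ hull X j U := by
  intro z hz
  obtain ⟨v, hv, hd⟩ := X.exists_vertex_near (k := (j : ℤ) + 1) (by omega) z
  have hzv : z ∈ v.ball := by
    rw [Vertex.ball, Metric.mem_ball]
    linarith [hv ▸ hd, v.radius_pos]
  exact Set.mem_iUnion₂.2 ⟨v, ⟨hv, z, hzv, hz⟩, hzv⟩

namespace Adapted

lemma hull_subset (h : 𝒰.Adapted X) (hl : a.level ≤ u.level) (hne : u ≠ a)
    (hm : (hull X u.level u.set ∩ a.set).Nonempty) : hull X u.level u.set ⊆ a.set :=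
  (h.separation c _ _ hl _ u.mem _ a.mem fun heq => hne (Subtype.ext heq)).resolve_right
    (Set.not_disjoint_iff_nonempty_inter.2 hm)

variable (h : 𝒰.Adapted X) (hk : X.k₀ ≤ 0)
include h hk

lemma hull_subset_of_isAncestor (ha : IsAncestor a u) : hull X u.level u.set ⊆ a.set := by
  obtain ⟨z, hz⟩ := u.set_nonempty
  exact h.hull_subset ha.1.le ha.ne ⟨z, subset_hull hk _ _ hz, ha.2 hz⟩

lemma isAncestor (hl : a.level < u.level) (hm : (u.set ∩ a.set).Nonempty) : IsAncestor a u := by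
  have hne : u ≠ a := fun heq => hl.ne (by rw [heq])
  refine ⟨hl, (subset_hull hk _ _).trans (h.hull_subset hl.le hne ?_)⟩
  exact hm.mono (Set.inter_subset_inter_left _ (subset_hull hk _ _))

lemma mem_ancestors (hl : a.level ≤ u.level) (hm : (u.set ∩ a.set).Nonempty) :
    a ∈ ancestors u := by
  rcases hl.eq_or_lt with hl | hl
  · exact .inl (TreeVertex.eq_of_inter_nonempty hl (by rwa [Set.inter_comm]))
  · exact .inr (h.isAncestor hk hl hm)

lemma mem_ancestors_iff (hp : IsParent p u) : a ∈ ancestors u ↔ a = u ∨ a ∈ ancestors p := by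
  refine or_congr_right ⟨fun ha => ?_, ?_⟩
  · obtain ⟨z, hz⟩ := u.set_nonempty
    exact h.mem_ancestors hk (hp.2 a ha) ⟨z, hp.1.2 hz, ha.2 hz⟩
  · rintro (rfl | ha)
    exacts [hp.1, ha.trans hp.1]

lemma symmDiff_ancestors (hp : IsParent p u) : symmDiff (ancestors p) (ancestors u) = {u} := by
  have hsub : ancestors p ≤ ancestors u := fun _ ha => (h.mem_ancestors_iff hk hp).2 (.inr ha)
  ext a
  rw [symmDiff_of_le hsub, Set.mem_sdiff, h.mem_ancestors_iff hk hp, Set.mem_singleton_iff]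
  refine ⟨fun ha => ha.1.resolve_right ha.2, ?_⟩
  rintro rfl
  exact ⟨.inl rfl, hp.notMem_ancestors⟩

lemma isTree (c : C) : (𝒰.tree c).IsTree := by
  refine ⟨𝒰.tree_connected c, SimpleGraph.isAcyclic_iff_forall_adj_isBridge.2 ?_⟩
  have hmem : ∀ {p u p' u' : 𝒰.TreeVertex c}, IsParent p u → IsParent p' u' →
      s(p', u') ≠ s(p, u) → (u ∈ ancestors p' ↔ u ∈ ancestors u') := fun hp hp' hne => by
    rw [h.mem_ancestors_iff hk hp', or_iff_right]
    rintro rfl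
    exact hne (by rw [hp.unique hp'])
  have hbridge : ∀ {p u : 𝒰.TreeVertex c}, IsParent p u → (𝒰.tree c).IsBridge s(p, u) := by
    intro p u hp
    refine isBridge_of_forall_mem_iff (S := {x | u ∈ ancestors x}) hp.notMem_ancestors (.inl rfl) ?_
    rintro a b (hab | hba) hne
    · exact hmem hp hab hne
    · exact (hmem hp hba (by rwa [Sym2.eq_swap])).symm
  rintro u w (huw | hwu)
  · exact hbridge huw
  · rw [Sym2.eq_swap]
    exact hbridge hwu

lemma encard_diff_add_encard_diff_le_dist (u w : 𝒰.TreeVertex c) :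
    (ancestors u \ ancestors w).encard + (ancestors w \ ancestors u).encard ≤
      (𝒰.tree c).dist u w := by
  obtain ⟨q, hq⟩ := (𝒰.tree_connected c).exists_walk_length_eq_dist u w
  rw [← Set.encard_union_eq disjoint_sdiff_sdiff, ← Set.symmDiff_def, ← hq]
  refine encard_symmDiff_le_length ?_ q
  rintro a b (hab | hba)
  · rw [h.symmDiff_ancestors hk hab, Set.encard_singleton]
  · rw [symmDiff_comm, h.symmDiff_ancestors hk hba, Set.encard_singleton]

end Adapted

end Tree

/-! ### The maps into the colored trees -/

section TreeMap

variable {u v w x : X.Vertex} {a q : 𝒰.TreeVertex c}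

lemma ball_subset_treeMap (v : X.Vertex) : v.ball ⊆ (𝒰.treeMap c v).set :=
  (Classical.choose_spec (𝒰.mapLevel_spec c v)).2

lemma level_treeMap_le (c : C) (v : X.Vertex) :
    (𝒰.treeMap c v).level ≤ (v.level - 1).toNat := by
  classical
  exact Nat.findGreatest_le _

lemma le_level_treeMap (ha : v.ball ⊆ a.set) (hl : a.level ≤ (v.level - 1).toNat) :
    a.level ≤ (𝒰.treeMap c v).level := by
  classical
  exact Nat.le_findGreatest hl ⟨a.set, a.mem, ha⟩

lemma ball_subset_hull (hk : X.k₀ ≤ 0) (hm : (v.ball ∩ a.set).Nonempty)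
    (hl : (a.level : ℤ) + 1 ≤ v.level) : v.ball ⊆ hull X a.level a.set := by
  obtain ⟨x, hx, -, hvx⟩ := v.exists_descent (k := (a.level : ℤ) + 1) (by omega) hl
  exact hvx.ball_subset.trans (Set.subset_biUnion_of_mem (u := Vertex.ball)
    ⟨hx, hm.mono (Set.inter_subset_inter_left _ hvx.ball_subset)⟩)

variable (𝒰) in
/-- The children of `f_c(u)` of index below `ℓ(u)` that meet `B(u)`. If a radial edge from `u` to
`v` is mapped to two vertices at distance `2`, the vertex between them is one of these. -/
def nearChildren (c : C) (u : X.Vertex) : Set (𝒰.TreeVertex c) :=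
  {q | IsParent (𝒰.treeMap c u) q ∧ (q.level : ℤ) + 1 ≤ u.level ∧ (u.ball ∩ q.set).Nonempty}

namespace Adapted

variable (h : 𝒰.Adapted X) (hk : X.k₀ ≤ 0)
include h hk

lemma mem_ancestors_treeMap (ha : v.ball ⊆ a.set) (hl : a.level ≤ (v.level - 1).toNat) :
    a ∈ ancestors (𝒰.treeMap c v) :=
  h.mem_ancestors hk (le_level_treeMap ha hl)
    ⟨v.center, ball_subset_treeMap v v.center_mem_ball, ha v.center_mem_ball⟩

lemma isParent_treeMap (hm : (v.ball ∩ a.set).Nonempty) (hl : (a.level : ℤ) + 1 ≤ v.level)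
    (hlt : (𝒰.treeMap c v).level < a.level) : IsParent (𝒰.treeMap c v) a := by
  refine ⟨h.isAncestor hk hlt ?_, fun b hb => le_level_treeMap ?_ ?_⟩
  · rw [Set.inter_comm]
    exact hm.mono (Set.inter_subset_inter_left _ (ball_subset_treeMap v))
  · exact (ball_subset_hull hk hm hl).trans (h.hull_subset_of_isAncestor hk hb)
  · have := hb.1
    omega

lemma dist_treeMap_le_one_of_inter_nonempty (hl : v.level = w.level)
    (hm : (v.ball ∩ w.ball).Nonempty) :
    (𝒰.tree c).dist (𝒰.treeMap c v) (𝒰.treeMap c w) ≤ 1 := by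
  wlog hle : (𝒰.treeMap c v).level ≤ (𝒰.treeMap c w).level generalizing v w
  · rw [SimpleGraph.dist_comm]
    exact this hl.symm (by rwa [Set.inter_comm]) (le_of_not_ge hle)
  rcases hle.eq_or_lt with heq | hlt
  · rw [TreeVertex.eq_of_inter_nonempty heq
      (hm.mono (Set.inter_subset_inter (ball_subset_treeMap v) (ball_subset_treeMap w))),
      SimpleGraph.dist_self]
    exact zero_le_one
  · have hlw := 𝒰.level_treeMap_le c w
    have hparent := h.isParent_treeMap hk
      (hm.mono (Set.inter_subset_inter_right _ (ball_subset_treeMap w))) (by omega) hlt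
    exact (SimpleGraph.dist_eq_one_iff_adj.2 hparent.adj).le

lemma subsingleton_nearChildren (c : C) (u : X.Vertex) :
    (𝒰.nearChildren c u).Subsingleton := by
  rintro q ⟨hq, hl, hm⟩ q' ⟨hq', hl', hm'⟩
  wlog hle : q'.level ≤ q.level generalizing q q'
  · exact (this hq' hl' hm' hq hl hm (le_of_not_ge hle)).symm
  by_contra hne
  have hball := ball_subset_hull hk hm hl
  have hsub := h.hull_subset hle hne (hm'.mono (Set.inter_subset_inter_left _ hball))
  exact (le_level_treeMap (hball.trans hsub) (by omega)).not_gt hq'.1.1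

lemma dist_treeMap_le_one_or_exists_nearChild (huv : Radial u v) (c : C) :
    (𝒰.tree c).dist (𝒰.treeMap c u) (𝒰.treeMap c v) ≤ 1 ∨
      ∃ q ∈ 𝒰.nearChildren c u, IsParent q (𝒰.treeMap c v) := by
  have hu := 𝒰.level_treeMap_le c u
  have hv := 𝒰.level_treeMap_le c v
  have hl := huv.1
  have hmeet : ∀ a ∈ ancestors (𝒰.treeMap c v), (u.ball ∩ a.set).Nonempty := fun a ha =>
    ⟨v.center, huv.2 v.center_mem_ball,
      set_subset_of_mem_ancestors ha (ball_subset_treeMap v v.center_mem_ball)⟩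
  have hmem : 𝒰.treeMap c u ∈ ancestors (𝒰.treeMap c v) :=
    h.mem_ancestors_treeMap hk (huv.2.trans (ball_subset_treeMap u)) (by omega)
  rcases hmem with heq | hanc
  · exact .inl (by rw [heq, SimpleGraph.dist_self]; exact zero_le_one)
  obtain ⟨q, hq⟩ := TreeVertex.exists_parent (Nat.ne_zero_of_lt hanc.1)
  rcases ((h.mem_ancestors_iff hk hq).1 (.inr hanc)).resolve_left hanc.ne.symm with heq | hanc'
  · exact .inl (SimpleGraph.dist_eq_one_iff_adj.2 (heq ▸ hq).adj).le
  · have hql : (q.level : ℤ) + 1 ≤ u.level := by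
      have := hq.1.1
      omega
    have hqm := hmeet q (.inr hq.1)
    exact .inr ⟨q, ⟨h.isParent_treeMap hk hqm hql hanc'.1, hql, hqm⟩, hq⟩

lemma dist_treeMap_le_two_of_radial (huv : Radial u v) (c : C) :
    (𝒰.tree c).dist (𝒰.treeMap c u) (𝒰.treeMap c v) ≤ 2 := by
  rcases h.dist_treeMap_le_one_or_exists_nearChild hk huv c with hle | ⟨q, hq, hqv⟩
  · exact hle.trans one_le_two
  · exact SimpleGraph.dist_le (.cons hq.1.adj (.cons hqv.adj .nil))

lemma dist_treeMap_le_three_of_horizontal [BoundedSpace Z] (hvw : Horizontal v w) (c : C) :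
    (𝒰.tree c).dist (𝒰.treeMap c v) (𝒰.treeMap c w) ≤ 3 := by
  obtain ⟨u, huv, hall⟩ := exists_radial_forall_horizontal hvw.k₀_lt
  have huw := hall w hvw
  have htri := (𝒰.tree_connected c).dist_triangle
    (u := 𝒰.treeMap c v) (v := 𝒰.treeMap c u) (w := 𝒰.treeMap c w)
  rw [SimpleGraph.dist_comm (v := 𝒰.treeMap c u)] at htri
  have hv2 := h.dist_treeMap_le_two_of_radial hk huv c
  have hw2 := h.dist_treeMap_le_two_of_radial hk huw c
  rcases h.dist_treeMap_le_one_or_exists_nearChild hk huv c with hv1 | ⟨q, hq, hqv⟩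
  · omega
  rcases h.dist_treeMap_le_one_or_exists_nearChild hk huw c with hw1 | ⟨q', hq', hqw⟩
  · omega
  obtain rfl := h.subsingleton_nearChildren hk c u hq hq'
  have hsiblings := SimpleGraph.dist_le (.cons hqv.adj.symm (.cons hqw.adj .nil))
  exact hsiblings.trans (Nat.le_succ 2)

lemma dist_treeMap_le_of_descent {n : ℕ} (hvx : Descent n v x) (c : C) :
    (𝒰.tree c).dist (𝒰.treeMap c v) (𝒰.treeMap c x) ≤ 2 * n := by
  induction hvx with
  | nil => rw [SimpleGraph.dist_self]
  | snoc _ hy ih =>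
    refine (𝒰.tree_connected c).dist_triangle.trans (add_le_add ih ?_)
    rw [SimpleGraph.dist_comm]
    exact h.dist_treeMap_le_two_of_radial hk hy c

lemma dist_treeMap_le_of_valleyPath [BoundedSpace Z] {N : ℕ} (hvw : ValleyPath v w N) (c : C) :
    (𝒰.tree c).dist (𝒰.treeMap c v) (𝒰.treeMap c w) ≤ 2 * N + 1 := by
  have hconn := 𝒰.tree_connected c
  induction hvw with
  | descend hvx => exact (h.dist_treeMap_le_of_descent hk hvx c).trans (Nat.le_succ _)
  | across hvx hxy =>
    have hle := hconn.dist_triangle.trans (add_le_add (h.dist_treeMap_le_of_descent hk hvx c)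
      (h.dist_treeMap_le_three_of_horizontal hk hxy c))
    omega
  | ascend _ hw ih =>
    have hle := hconn.dist_triangle.trans
      (add_le_add ih (h.dist_treeMap_le_two_of_radial hk hw c))
    omega

lemma dist_treeMap_le [BoundedSpace Z] (c : C) (v w : X.Vertex) :
    (𝒰.tree c).dist (𝒰.treeMap c v) (𝒰.treeMap c w) ≤ 2 * X.graph.dist v w + 1 := by
  obtain ⟨N, hN, hpath⟩ := exists_valleyPath v w
  exact (h.dist_treeMap_le_of_valleyPath hk hpath c).trans (by omega)

lemma dist_treeMap_le_two_mul [BoundedSpace Z]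
    (hX : ∀ v w : X.Vertex, X.graph.Adj v w → (v.ball ∩ w.ball).Nonempty) (c : C)
    (v w : X.Vertex) :
    (𝒰.tree c).dist (𝒰.treeMap c v) (𝒰.treeMap c w) ≤ 2 * X.graph.dist v w := by
  have : Nonempty Z := ⟨v.center⟩
  refine dist_le_mul_dist_of_adj X.graph_connected (𝒰.tree_connected c) (fun v w hvw => ?_) v w
  rcases hvw with hor | hrad | hrad
  · exact (h.dist_treeMap_le_one_of_inter_nonempty hk hor.2.1 (hX v w hor.adj)).trans one_le_two
  · exact h.dist_treeMap_le_two_of_radial hk hrad c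
  · rw [SimpleGraph.dist_comm]
    exact h.dist_treeMap_le_two_of_radial hk hrad c

lemma prodDist_le [BoundedSpace Z] [Fintype C] (v w : X.Vertex) :
    𝒰.prodDist v w ≤ Fintype.card C * (2 * X.graph.dist v w + 1) := by
  rw [← nsmul_eq_mul, ← Finset.card_univ]
  exact Finset.sum_le_card_nsmul _ _ _ fun c _ => mod_cast h.dist_treeMap_le hk c v w

end Adapted

end TreeMap

end CoverSeq

end ColoredTrees

/-! ### The lower bound -/

namespace ColoredTrees

open HypApprox

lemma HypApprox.exists_branchLevel {Z : Type*} [MetricSpace Z] [BoundedSpace Z] {r : ℝ}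
    {X : HypApprox Z r} (v w : X.Vertex) :
    ∃ m, X.k₀ ≤ m ∧ m ≤ v.level ∧ m ≤ w.level ∧ dist v.center w.center ≤ r ^ m ∧
      (m < v.level → m < w.level → r ^ (m + 1) < dist v.center w.center) := by
  have hdist : dist v.center w.center ≤ r ^ X.k₀ := (Metric.dist_le_diam_of_mem
    (Bornology.IsBounded.all _) (Set.mem_univ _) (Set.mem_univ _)).trans X.isGreatest.1.le
  obtain ⟨m, ⟨hk, hv, hw, hd⟩, hmax⟩ := Int.exists_greatest_of_bdd
    (P := fun m => X.k₀ ≤ m ∧ m ≤ v.level ∧ m ≤ w.level ∧ dist v.center w.center ≤ r ^ m)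
    ⟨v.level, fun m hm => hm.2.1⟩ ⟨X.k₀, le_rfl, v.k₀_le, w.k₀_le, hdist⟩
  refine ⟨m, hk, hv, hw, hd, fun hv' hw' => not_le.1 fun hle => ?_⟩
  exact (lt_add_one m).not_ge (hmax (m + 1) ⟨by omega, hv', hw', hle⟩)

namespace CoverSeq.Adapted

variable {Z C : Type*} [MetricSpace Z] {𝒰 : CoverSeq Z C} {c : C} {r : ℝ} {X : HypApprox Z r}
  {v w : X.Vertex} {m : ℤ}

lemma dist_lt_of_mem (h : 𝒰.Adapted X) {a : 𝒰.TreeVertex c} (ha : 1 ≤ a.level) {x y : Z}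
    (hx : x ∈ a.set) (hy : y ∈ a.set) : dist x y < r ^ a.level := by
  rw [← ENNReal.ofReal_lt_ofReal_iff (pow_pos X.pos _), ← edist_dist]
  exact (edist_le_mesh a.mem hx hy).trans_lt (h.mesh_lt a.level ha)

/-- The ball of `v` lies in a member of each index `j < ℓ(v)`, and that member cannot contain the
center of `w` as soon as its diameter bound `r ^ j` is below the distance of the centers. -/
lemma exists_mem_ancestors_diff (h : 𝒰.Adapted X) (hk : X.k₀ ≤ 0)
    (hsep : m < v.level → m < w.level → r ^ (m + 1) < dist v.center w.center) {j : ℕ}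
    (hj : 1 ≤ j) (hmj : m + 1 ≤ j) (hjv : (j : ℤ) + 1 ≤ v.level) :
    ∃ c, ∃ a ∈ ancestors (𝒰.treeMap c v) \ ancestors (𝒰.treeMap c w), a.level = j := by
  obtain ⟨x, hx, -, hvx⟩ := v.exists_descent (k := (j : ℤ) + 1) (by omega) hjv
  obtain ⟨c, U, hU, hxU⟩ := h.ball_subset j x hx
  let a : 𝒰.TreeVertex c := ⟨(j, U), hU⟩
  have hal : a.level = j := rfl
  have hva : v.ball ⊆ a.set := hvx.ball_subset.trans hxU
  refine ⟨c, a, ⟨h.mem_ancestors_treeMap hk hva (by omega), fun haw => ?_⟩, hal⟩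
  have hmw : m < w.level := by
    have hle := (level_le_of_mem_ancestors haw).trans (𝒰.level_treeMap_le c w)
    omega
  have hdist : dist v.center w.center < r ^ j :=
    h.dist_lt_of_mem (a := a) hj (hva v.center_mem_ball)
      (set_subset_of_mem_ancestors haw (ball_subset_treeMap w w.center_mem_ball))
  have hpow : r ^ (j : ℤ) ≤ r ^ (m + 1) :=
    zpow_le_zpow_right_of_le_one₀ X.pos (by linarith [X.le_sixth]) hmj
  rw [zpow_natCast] at hpow
  linarith [hsep (by omega) hmw]

lemma toNat_sub_le_sum_encard_diff [Fintype C] (h : 𝒰.Adapted X) (hk : X.k₀ ≤ 0)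
    (hsep : m < v.level → m < w.level → r ^ (m + 1) < dist v.center w.center) :
    ((v.level - max (m + 1) 1).toNat : ℕ∞) ≤
      ∑ c, (ancestors (𝒰.treeMap c v) \ ancestors (𝒰.treeMap c w)).encard := by
  have hcover : (Finset.Ico (max (m + 1) 1).toNat v.level.toNat : Set ℕ) ⊆ ⋃ c,
      TreeVertex.level '' (ancestors (𝒰.treeMap c v) \ ancestors (𝒰.treeMap c w)) := fun j hj => by
    rw [Finset.mem_coe, Finset.mem_Ico] at hj
    exact Set.mem_iUnion.2 (h.exists_mem_ancestors_diff hk hsep (by omega) (by omega) (by omega))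
  have hcard := (Set.encard_le_encard hcover).trans (Set.encard_iUnion_le_of_fintype _)
  rw [Set.encard_coe_eq_coe_finsetCard, Nat.card_Ico] at hcard
  calc ((v.level - max (m + 1) 1).toNat : ℕ∞)
      = (v.level.toNat - (max (m + 1) 1).toNat : ℕ) := congrArg _ (by omega)
    _ ≤ _ := hcard.trans (Finset.sum_le_sum fun c _ => Set.encard_image_le _ _)

lemma graph_dist_le_sum_dist [BoundedSpace Z] [Fintype C] (h : 𝒰.Adapted X) (hk : X.k₀ ≤ 0)
    (v w : X.Vertex) : (X.graph.dist v w : ℤ) ≤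
      ↑(∑ c, (𝒰.tree c).dist (𝒰.treeMap c v) (𝒰.treeMap c w)) + 3 - 2 * X.k₀ := by
  obtain ⟨m, hkm, hmv, hmw, hd, hsep⟩ := exists_branchLevel v w
  have hsep' : m < w.level → m < v.level → r ^ (m + 1) < dist w.center v.center :=
    fun hw hv => dist_comm v.center w.center ▸ hsep hv hw
  have hsum : (v.level - max (m + 1) 1).toNat + (w.level - max (m + 1) 1).toNat ≤
      ∑ c, (𝒰.tree c).dist (𝒰.treeMap c v) (𝒰.treeMap c w) := by
    have hle := add_le_add (h.toNat_sub_le_sum_encard_diff hk hsep)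
      (h.toNat_sub_le_sum_encard_diff hk hsep')
    rw [← Finset.sum_add_distrib] at hle
    exact_mod_cast hle.trans
      (Finset.sum_le_sum fun c _ => h.encard_diff_add_encard_diff_le_dist hk _ _)
  have hdist := graph_dist_le hkm hmv hmw hd
  omega

lemma graph_dist_le_prodDist [BoundedSpace Z] [Fintype C] (h : 𝒰.Adapted X) (hk : X.k₀ ≤ 0)
    (v w : X.Vertex) : (X.graph.dist v w : ℝ) ≤ 𝒰.prodDist v w + 3 - 2 * X.k₀ := by
  rw [prodDist]
  exact_mod_cast h.graph_dist_le_sum_dist hk v w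

end CoverSeq.Adapted

end ColoredTrees

open ColoredTrees HypApprox

theorem theorem6p1_general (n K : ℕ) :
    ∃ a₁ a₂ b : ℝ, 0 < a₁ ∧ 0 < a₂ ∧ 0 ≤ b ∧
      ∀ (Z : Type*) [MetricSpace Z] [BoundedSpace Z] [Nonempty Z],
        (CapDimProperty Z n → ∃ r₀ : ℝ, 0 < r₀ ∧ ∀ r : ℝ, 0 < r → r < r₀ →
          ∃ 𝒰 : CoverSeq Z (Fin (n + 1)), ∀ X : HypApprox Z r, 𝒰.Adapted X) ∧
        ∀ (r : ℝ) (X : HypApprox Z r) (𝒰 : CoverSeq Z (Fin (n + 1))),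
          X.k₀ ≤ 0 → -(K : ℤ) ≤ X.k₀ → 𝒰.Adapted X →
          X.graph.Connected ∧ (∀ c, (𝒰.tree c).IsTree) ∧
          (∀ v w : X.Vertex, a₁ * (X.graph.dist v w : ℝ) - b ≤ 𝒰.prodDist v w ∧
            𝒰.prodDist v w ≤ a₂ * (X.graph.dist v w : ℝ) + b) ∧
          (∀ c, ∀ v w : X.Vertex,
            (𝒰.tree c).dist (𝒰.treeMap c v) (𝒰.treeMap c w) ≤ 2 * X.graph.dist v w + 1) ∧
          ((∀ v w : X.Vertex, X.graph.Adj v w → (v.ball ∩ w.ball).Nonempty) →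
            ∀ c, ∀ v w : X.Vertex,
              (𝒰.tree c).dist (𝒰.treeMap c v) (𝒰.treeMap c w) ≤ 2 * X.graph.dist v w) := by
  refine ⟨1, 2 * (n + 1), n + 1 + (3 + 2 * K), one_pos, by positivity, by positivity, ?_⟩
  intro Z _ _ _
  refine ⟨CapDimProperty.exists_adapted, fun r X 𝒰 hk hK h => ⟨X.graph_connected, h.isTree hk,
    fun v w => ⟨?_, ?_⟩, h.dist_treeMap_le hk, h.dist_treeMap_le_two_mul hk⟩⟩
  · have hlower := h.graph_dist_le_prodDist hk v w
    have hK' : -(K : ℝ) ≤ X.k₀ := mod_cast hK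
    linarith [(n.cast_nonneg : (0 : ℝ) ≤ n)]
  · have hupper := h.prodDist_le hk v w
    rw [Fintype.card_fin, Nat.cast_succ] at hupper
    linarith [(K.cast_nonneg : (0 : ℝ) ≤ K)]

theorem theorem6p1 (n : ℕ) :
    ∃ a₁ a₂ b : ℝ, 0 < a₁ ∧ 0 < a₂ ∧ 0 ≤ b ∧
      ∀ (Z : Type*) [MetricSpace Z] [BoundedSpace Z] [Nontrivial Z],
        ColoredTrees.IsCapDim Z n →
        -- for every small parameter there are covering sequences of the required kind
        (∃ r₀ : ℝ, 0 < r₀ ∧ ∀ r : ℝ, 0 < r → r < r₀ →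
          ∃ 𝒰 : ColoredTrees.CoverSeq Z (Fin (n + 1)),
            ∀ X : ColoredTrees.HypApprox Z r, 𝒰.Adapted X) ∧
        -- and for every such sequence the following holds
        ∀ (r : ℝ) (X : ColoredTrees.HypApprox Z r)
          (𝒰 : ColoredTrees.CoverSeq Z (Fin (n + 1))),
          r < Metric.diam (Set.univ : Set Z) → r < 1 / Metric.diam (Set.univ : Set Z) →
          𝒰.Adapted X →
          X.graph.Connected ∧ (∀ c, (𝒰.tree c).IsTree) ∧
          -- the product map is quasi-isometric
          (∀ v w : X.Vertex,
            a₁ * (X.graph.dist v w : ℝ) - b ≤ 𝒰.prodDist v w ∧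
            𝒰.prodDist v w ≤ a₂ * (X.graph.dist v w : ℝ) + b) ∧
          -- Lipschitz estimates for the factors
          (∀ c, ∀ v w : X.Vertex,
            (𝒰.tree c).dist (𝒰.treeMap c v) (𝒰.treeMap c w) ≤ 2 * X.graph.dist v w + 1) ∧
          ((∀ v w : X.Vertex, X.graph.Adj v w → (v.ball ∩ w.ball).Nonempty) →
            ∀ c, ∀ v w : X.Vertex,
              (𝒰.tree c).dist (𝒰.treeMap c v) (𝒰.treeMap c w) ≤ 2 * X.graph.dist v w) := by
  obtain ⟨a₁, a₂, b, ha₁, ha₂, hb, h⟩ := theorem6p1_general n 1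
  exact ⟨a₁, a₂, b, ha₁, ha₂, hb, fun Z _ _ _ hZ => ⟨(h Z).1 hZ.1, fun r X 𝒰 hr hr' =>
    (h Z).2 r X 𝒰 (k₀_nonpos hr.le) (neg_one_le_k₀ (X.pos.trans hr) hr')⟩⟩
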